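/- Let $X$ be a real Banach space with dual $X^*$ and let $f\colon X\to\mathbb{R}\cup\{+\infty\}$ be a closed (that is, lower semicontinuous) convex function with effective domain $\operatorname{dom} f=\{x\in X : f(x)\in\mathbb{R}\}$. Equip $\mathbb{R}\times X^*$ with the norm $\|(a,x^*)\|=|a|+\|x^*\|$, let $d_{PH}$ be the corresponding Pompeiu--Hausdorff distance between nonempty subsets of $\mathbb{R}\times X^*$, and call the product of the usual topology of $\mathbb{R}$ and $\sigma(X^*,X)$ the weak$^*$ topology of $\mathbb{R}\times X^*$. A hypodifferential of $f$ at $x\in\operatorname{dom} f$ is a weak$^*$ compact set $\underline{d}f(x)\subset\mathbb{R}\times X^*$ such that $\max_{(a,x^*)\in\underline{d}f(x)}a=0$ and, for every $u\in X$, $$\lim_{\alpha\to+0}\frac1\alpha\Big|f(x+\alpha u)-f(x)-\max_{(a,x^*)\in\underline{d}f(x)}\big(a+\alpha\langle x^*,u\rangle\big)\Big|=0.$$ Let $Q\subseteq\operatorname{int}\operatorname{dom} f$ be a convex set and $L>0$. For each $x\in Q$ let $\underline{d}f(x)$ be a hypodifferential of $f$ at $x$, and suppose that this map is consistent on $Q$,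 i.e. $f(y)-f(x)\ge a+\langle x^*,y-x\rangle$ for all $x\in Q$, $y\in X$ and $(a,x^*)\in\underline{d}f(x)$, and Lipschitz continuous on $Q$ with constant $L$, i.e. $d_{PH}(\underline{d}f(x),\underline{d}f(y))\le L\|x-y\|$ for all $x,y\in Q$. Then for all $x,y\in Q$ the maximum below is attained and $$0\le f(y)-f(x)-\max_{(a,x^*)\in\underline{d}f(x)}\big(a+\langle x^*,y-x\rangle\big)\le L\|y-x\|\big(1+\|y-x\|\big).$$ -/

import Mathlib

open Filter Topology

noncomputable section

namespace Hypo

/-- The space `ℝ × X*` with the norm `‖(a, x*)‖ = |a| + ‖x*‖`. -/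
abbrev AffSpace (X : Type*) [NormedAddCommGroup X] [NormedSpace ℝ X] : Type _ :=
  WithLp 1 (ℝ × StrongDual ℝ X)

/-- The effective domain of an extended real valued function. -/
def effDom {X : Type*} (f : X → EReal) : Set X :=
  {x | f x ≠ ⊤ ∧ f x ≠ ⊥}

/-- `f : X → ℝ ∪ {+∞}` is a closed convex function: it never takes the value `-∞`, it is lower
semicontinuous, and its epigraph in `X × ℝ` is convex. -/
structure IsClosedConvex {X : Type*} [NormedAddCommGroup X] [NormedSpace ℝ X]
    (f : X → EReal) : Prop where
  ne_bot : ∀ x, f x ≠ ⊥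
  lsc : LowerSemicontinuous f
  convex_epigraph : Convex ℝ {p : X × ℝ | f p.1 ≤ (p.2 : EReal)}

/-- Weak* compactness in `ℝ × X*`: compactness for the product of the usual topology of `ℝ` and
the topology `σ(X*, X)`. -/
def IsWeakStarCompact {X : Type*} [NormedAddCommGroup X] [NormedSpace ℝ X]
    (H : Set (AffSpace X)) : Prop :=
  IsCompact ((fun p : AffSpace X =>
    ((p.fst, StrongDual.toWeakDual p.snd) : ℝ × WeakDual ℝ X)) '' H)

/-- The set of values `a + ⟨x*, u⟩`, `(a, x*) ∈ H`. -/
def affValues {X : Type*} [NormedAddCommGroup X] [NormedSpace ℝ X]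
    (H : Set (AffSpace X)) (u : X) : Set ℝ :=
  (fun p : AffSpace X => p.fst + p.snd u) '' H

/-- `max_{(a, x*) ∈ H} (a + ⟨x*, u⟩)`; the supremum is attained when `H` is nonempty and
weak* compact. -/
def affMax {X : Type*} [NormedAddCommGroup X] [NormedSpace ℝ X]
    (H : Set (AffSpace X)) (u : X) : ℝ :=
  sSup (affValues H u)

/-- `H` is a hypodifferential of `f` at `x`. The difference quotient is taken in `[0, +∞]`, since
`f (x + α • u)` may be `+∞`. -/
structure IsHypodifferentialAt {X : Type*} [NormedAddCommGroup X] [NormedSpace ℝ X]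
    (f : X → EReal) (x : X) (H : Set (AffSpace X)) : Prop where
  mem_effDom : x ∈ effDom f
  compact : IsWeakStarCompact H
  approx : ∀ u : X, Tendsto
    (fun α : ℝ => (f (x + α • u) - f x - ((affMax H (α • u) : ℝ) : EReal)).abs / ENNReal.ofReal α)
    (𝓝[>] 0) (𝓝 0)
  max_fst : IsGreatest ((fun p : AffSpace X => p.fst) '' H) 0

/-- `D` is a hypodifferential map of `f` on `Q` (only the values of `D` on `Q` matter). -/
def IsHypodifferentialMapOn {X : Type*} [NormedAddCommGroup X] [NormedSpace ℝ X]
    (f : X → EReal) (D : X → Set (AffSpace X)) (Q : Set X) : Prop :=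
  ∀ x ∈ Q, IsHypodifferentialAt f x (D x)

/-- Consistency on `Q`: every element of `D x`, `x ∈ Q`, gives an affine minorant of `f` on the
whole space. -/
def IsConsistentOn {X : Type*} [NormedAddCommGroup X] [NormedSpace ℝ X]
    (f : X → EReal) (D : X → Set (AffSpace X)) (Q : Set X) : Prop :=
  ∀ x ∈ Q, ∀ y : X, ∀ p ∈ D x, ((p.fst + p.snd (y - x) : ℝ) : EReal) ≤ f y - f x

/-- Lipschitz continuity on `Q` for the Pompeiu-Hausdorff distance of `ℝ × X*`. -/
def IsHausdorffLipschitzOn {X : Type*} [NormedAddCommGroup X] [NormedSpace ℝ X]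
    (D : X → Set (AffSpace X)) (L : ℝ) (Q : Set X) : Prop :=
  ∀ x ∈ Q, ∀ y ∈ Q, Metric.hausdorffEDist (D x) (D y) ≤ ENNReal.ofReal (L * ‖x - y‖)

end Hypo

end

namespace Hypo

variable {X : Type*} [NormedAddCommGroup X] [NormedSpace ℝ X]

/-! The lower bound is consistency at `x`. For the upper bound, pick `(0, x*)` in `D y`; consistency
at `y`, tested at `x`, gives `f y - f x ≤ ⟨x*, y - x⟩`. Lipschitz continuity moves `(0, x*)` to a
nearby element of `D x`, at a cost of about `L‖y - x‖` in each component, hence the factor `1 + ‖y -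
x‖`. -/

/-- The affine functions coming from a nonempty weak* compact set attain their maximum at every
point. -/
theorem IsWeakStarCompact.isGreatest_affMax {H : Set (AffSpace X)} (hc : IsWeakStarCompact H)
    (hne : H.Nonempty) (u : X) : IsGreatest (affValues H u) (affMax H u) := by
  have hcont : Continuous (fun q : ℝ × WeakDual ℝ X => q.1 + q.2 u) :=
    continuous_fst.add ((WeakDual.eval_continuous u).comp continuous_snd)
  have himg : IsCompact (affValues H u) := by
    have h := hc.image hcont
    rw [Set.image_image] at h
    exact h
  exact himg.isGreatest_sSup (hne.image _)

/-- An element of `K` is matched, up to any `r > hausdorffEDist H K`, by an element of `H`, which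
bounds its affine value by `affMax H u`. -/
theorem le_affMax_add_of_hausdorffEDist_lt {H K : Set (AffSpace X)} {u : X} {r : ℝ}
    (hmax : BddAbove (affValues H u)) (hr : Metric.hausdorffEDist H K < ENNReal.ofReal r)
    {q : AffSpace X} (hq : q ∈ K) : q.fst + q.snd u ≤ affMax H u + r * (1 + ‖u‖) := by
  obtain ⟨p, hp, hpq⟩ := Metric.exists_edist_lt_of_hausdorffEDist_lt hq
    (by rwa [Metric.hausdorffEDist_comm])
  have hr0 : 0 < r := ENNReal.ofReal_pos.mp (pos_of_gt hr)
  rw [edist_dist, ENNReal.ofReal_lt_ofReal_iff hr0, dist_eq_norm,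
    WithLp.prod_norm_eq_of_L1] at hpq
  have hfst : q.fst - p.fst ≤ ‖(q - p).fst‖ := le_abs_self _
  have hsnd : (q.snd - p.snd) u ≤ ‖(q - p).snd‖ * ‖u‖ :=
    (le_abs_self _).trans ((q - p).snd.le_opNorm u)
  rw [sub_apply] at hsnd
  have hle : p.fst + p.snd u ≤ affMax H u := le_csSup hmax ⟨p, hp, rfl⟩
  -- In the sum norm each component of `q - p` is separately below `r`.
  have h1 : ‖(q - p).snd‖ * ‖u‖ ≤ r * ‖u‖ := by
    gcongr
    linarith [norm_nonneg (q - p).fst]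
  linarith [norm_nonneg (q - p).snd]

end Hypo

theorem mainTheorem12 {X : Type*} [NormedAddCommGroup X] [NormedSpace ℝ X] [CompleteSpace X]
    (f : X → EReal) (hf : Hypo.IsClosedConvex f)
    (Q : Set X) (hQ : Convex ℝ Q) (hQf : Q ⊆ interior (Hypo.effDom f))
    (D : X → Set (Hypo.AffSpace X)) (hD : Hypo.IsHypodifferentialMapOn f D Q)
    (hcons : Hypo.IsConsistentOn f D Q)
    (L : ℝ) (hL : 0 < L) (hLip : Hypo.IsHausdorffLipschitzOn D L Q) :
    ∀ x ∈ Q, ∀ y ∈ Q,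
      IsGreatest (Hypo.affValues (D x) (y - x)) (Hypo.affMax (D x) (y - x)) ∧
      0 ≤ f y - f x - ((Hypo.affMax (D x) (y - x) : ℝ) : EReal) ∧
      f y - f x - ((Hypo.affMax (D x) (y - x) : ℝ) : EReal) ≤
        ((L * ‖y - x‖ * (1 + ‖y - x‖) : ℝ) : EReal) := by
  intro x hx y hy
  have hgr := (hD x hx).compact.isGreatest_affMax (hD x hx).max_fst.nonempty.of_image (y - x)
  refine ⟨hgr, ?_⟩
  obtain ⟨p, hp, hpM⟩ := hgr.1
  obtain ⟨q, hq, hq0⟩ := (hD y hy).max_fst.1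
  have hlow := hcons x hx y p hp
  have hupp := hcons y hy x q hq
  -- Both values are finite, so the `EReal` differences become real ones.
  lift f x to ℝ using (hD x hx).mem_effDom with a
  lift f y to ℝ using (hD y hy).mem_effDom with b
  norm_cast at hlow hupp ⊢
  have hneg : q.snd (x - y) = -q.snd (y - x) := by rw [← map_neg, neg_sub]
  refine ⟨by linarith, ?_⟩
  -- A strict `r` yields a matching element without the Hausdorff infimum being attained; then `r`
  -- decreases to `L‖y - x‖`.
  have key : ∀ r > L * ‖y - x‖, q.snd (y - x) - Hypo.affMax (D x) (y - x) ≤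
      r * (1 + ‖y - x‖) := by
    intro r hr
    have hr0 : 0 < r := lt_of_le_of_lt (by positivity) hr
    have hlt : Metric.hausdorffEDist (D x) (D y) < ENNReal.ofReal r :=
      (hLip x hx y hy).trans_lt
        ((ENNReal.ofReal_lt_ofReal_iff hr0).2 (by rwa [norm_sub_rev]))
    have := Hypo.le_affMax_add_of_hausdorffEDist_lt hgr.bddAbove hlt hq
    linarith
  have hpos : 0 < 1 + ‖y - x‖ := by positivity
  have hlim : q.snd (y - x) - Hypo.affMax (D x) (y - x) ≤ L * ‖y - x‖ * (1 + ‖y - x‖) := by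
    rw [← div_le_iff₀ hpos]
    exact le_of_forall_gt_imp_ge_of_dense fun r hr => (div_le_iff₀ hpos).2 (key r hr)
  linarith
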